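/- Let $n\ge 1$ and let $V$ be a set of $n$ elements. A hypergraph on $V$ is given by a set of hyperedges, each of which is a subset of $V$ of cardinality at least $2$; the complete hypergraph $\overline{\mathcal K}_n$ has all such subsets as hyperedges, and its spanning subhypergraphs are the hypergraphs $(V,F)$ with $F\subseteq E(\overline{\mathcal K}_n)$. A walk is a sequence $(v_0,e_1,v_1,\dots,e_k,v_k)$ with $k\ge 0$ and $v_{i-1},v_i\in e_i\in F$ for $1\le i\le k$; it is a cycle if $k\ge 2$, $v_k=v_0$, the vertices $v_0,\dots,v_{k-1}$ are distinct and the hyperedges $e_1,\dots,e_k$ are distinct. A hyperforest is a hypergraph without cycles, a hypertree is a hyperforest in which any two vertices are connected by a walk, and the connected components of a hyperforest are its hypertrees. A rooted hyperforest is a hyperforest together with the choice of one vertex (the root) in each of its connected components. Let $S$ be a commutative $\mathbb Q$-algebra (for example $\mathbb C$, or a polynomial ring over $\mathbb Q$ in indeterminate weights), let $\mathbf w=(w_k)_{k\ge 2}$ be elements of $S$, and give every hyperforest with hyperedge set $F$ the weight $\prod_{A\in F}w_{|A|}$. Let $t_{n,r}=t_{n,r}(\mathbf w)$ be the sum of the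 weights of all rooted spanning hyperforests of $\overline{\mathcal K}_n$ with exactly $r$ connected components, and let $t_n=t_n(\mathbf w)$ be the sum of the weights of all rooted spanning hypertrees of $\overline{\mathcal K}_n$. Define $P_s(x;\mathbf w)$, for $s\ge 0$ and $x\in S$, by the identity of formal power series in $y$ $$\exp\Bigl[x\sum_{k\ge 2}w_k\frac{y^{k-1}}{(k-1)!}\Bigr]=\sum_{s\ge 0}P_s(x;\mathbf w)\frac{y^s}{s!}.$$ Then, for every $r\ge 1$, $$t_{n,r}=\binom{n-1}{r-1}P_{n-r}(n;\mathbf w),$$ where the right-hand side is read as $0$ if $r>n$. Moreover $t_{n,0}=0$, $t_{n,n}=1$, and $t_n=t_{n,1}=P_{n-1}(n;\mathbf w)$. -/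

import Mathlib

namespace HyperforestCount

/-! ### Hypergraphs on a finite vertex set

A hypergraph on the vertex set `V` is given by its finite set `E : Finset (Finset V)` of hyperedges,
each of cardinality at least two. A spanning subhypergraph of it is identified with its set of
hyperedges, a subset of `E`. -/

section Hypergraphs

variable {V : Type*}

/-- A walk `(v₀, e₁, v₁, …, eₖ, vₖ)` from `v₀` to `vₖ` in the hypergraph with hyperedge set `E`:
every `eᵢ` belongs to `E` and contains both `vᵢ₋₁` and `vᵢ`. -/
inductive Walk (E : Finset (Finset V)) : V → V → Type _
  | nil (v : V) : Walk E v v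
  | cons {u v x : V} (A : Finset V) (hA : A ∈ E) (hu : u ∈ A) (hv : v ∈ A) (p : Walk E v x) :
      Walk E u x

namespace Walk

variable {E : Finset (Finset V)}

/-- The number `k` of steps of a walk. -/
def length : {u v : V} → Walk E u v → ℕ
  | _, _, nil _ => 0
  | _, _, cons _ _ _ _ p => p.length + 1

/-- The vertices `v₀, …, vₖ₋₁` of a walk, all but the last one. -/
def initVertices : {u v : V} → Walk E u v → List V
  | _, _, nil _ => []
  | u, _, cons _ _ _ _ p => u :: p.initVertices

/-- The hyperedges `e₁, …, eₖ` of a walk. -/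
def edges : {u v : V} → Walk E u v → List (Finset V)
  | _, _, nil _ => []
  | _, _, cons A _ _ _ p => A :: p.edges

/-- A cycle is a closed walk (`vₖ = v₀`) in which `v₀, …, vₖ₋₁` are distinct, `e₁, …, eₖ` are
distinct, and `k ≥ 2`. -/
def IsCycle {v : V} (p : Walk E v v) : Prop :=
  p.initVertices.Nodup ∧ p.edges.Nodup ∧ 2 ≤ p.length

end Walk

/-- Two vertices are connected if there is a walk from one to the other. -/
def Reachable (E : Finset (Finset V)) (u v : V) : Prop :=
  Nonempty (Walk E u v)

/-- A hypergraph is connected if every pair of vertices can be connected by a walk. -/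
def IsConnected (E : Finset (Finset V)) : Prop :=
  ∀ u v : V, Reachable E u v

/-- A hyperforest is a hypergraph without cycles. -/
def IsHyperforest (E : Finset (Finset V)) : Prop :=
  ∀ (v : V) (p : Walk E v v), ¬ p.IsCycle

/-- A hypertree is a connected hyperforest. -/
def IsHypertree (E : Finset (Finset V)) : Prop :=
  IsHyperforest E ∧ IsConnected E

variable [Fintype V]

open Classical in
/-- The vertex set of the connected component of the vertex `v`. -/
noncomputable def component (E : Finset (Finset V)) (v : V) : Finset V :=
  Finset.univ.filter fun u => Reachable E v u

open Classical in
/-- The vertex sets of the connected components of a hypergraph. -/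
noncomputable def components (E : Finset (Finset V)) : Finset (Finset V) :=
  Finset.univ.image (component E)

/-- `R` is a choice of roots: it has exactly one vertex in each connected component. -/
def IsRootSet (E : Finset (Finset V)) (R : Finset V) : Prop :=
  ∀ C ∈ components E, ∃! v, v ∈ C ∧ v ∈ R

variable (V) in
/-- The hyperedges of the complete hypergraph on `V`: all subsets of cardinality at least two. -/
def completeHyperedges : Finset (Finset V) :=
  Finset.univ.filter fun A => 2 ≤ A.card

open Classical in
/-- The spanning hyperforests of the hypergraph with hyperedge set `E`. -/
noncomputable def spanningHyperforests (E : Finset (Finset V)) : Finset (Finset (Finset V)) :=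
  E.powerset.filter IsHyperforest

open Classical in
/-- The spanning hypertrees of the hypergraph with hyperedge set `E`. -/
noncomputable def spanningHypertrees (E : Finset (Finset V)) : Finset (Finset (Finset V)) :=
  E.powerset.filter IsHypertree

open Classical in
/-- The rooted spanning hyperforests with exactly `r` hypertrees (connected components) of the
hypergraph with hyperedge set `E`: pairs `(F, R)` of a spanning hyperforest `F` with `r` connected
components and a set `R` consisting of one root in each component. -/
noncomputable def rootedSpanningHyperforests (E : Finset (Finset V)) (r : ℕ) :
    Finset (Finset (Finset V) × Finset V) :=
  (spanningHyperforests E ×ˢ Finset.univ).filter fun FR =>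
    (components FR.1).card = r ∧ IsRootSet FR.1 FR.2

end Hypergraphs

section Weights

variable {S : Type*} [CommRing S]

/-- The weight of a set of hyperedges when a hyperedge of cardinality `k` has weight `w k`: the
product of the weights of its hyperedges. -/
def edgeWeight {V : Type*} (w : ℕ → S) (F : Finset (Finset V)) : S :=
  ∏ A ∈ F, w A.card

/-- The total weight `t_{n,r}(w)` of the rooted spanning hyperforests with `r` hypertrees in the
complete hypergraph on `V`, where `n` is the number of elements of `V`. -/
noncomputable def rootedHyperforestWeight (V : Type*) [Fintype V] (w : ℕ → S) (r : ℕ) : S :=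
  ∑ FR ∈ rootedSpanningHyperforests (completeHyperedges V) r, edgeWeight w FR.1

/-- The total weight `t_n(w)` of the rooted spanning hypertrees in the complete hypergraph on `V`
(pairs of a spanning hypertree and a vertex, its root), where `n` is the number of elements
of `V`. -/
noncomputable def rootedHypertreeWeight (V : Type*) [Fintype V] (w : ℕ → S) : S :=
  ∑ F ∈ spanningHypertrees (completeHyperedges V), ∑ _root : V, edgeWeight w F

end Weights

/-! ### The polynomials `P_s(x; w)` -/

section Series

open PowerSeries

variable {S : Type*} [CommRing S] [Algebra ℚ S]

/-- The formal power series `∑_{k ≥ 2} w_k y^{k-1} / (k-1)!` in `y`: the coefficient of `y^m` is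
`w_{m+1} / m!` for `m ≥ 1`, and `0` for `m = 0`. -/
noncomputable def weightSeries (w : ℕ → S) : S⟦X⟧ :=
  PowerSeries.mk fun m => if m = 0 then 0 else ((m.factorial : ℚ)⁻¹) • w (m + 1)

/-- The formal power series `θ(x, y; w) = exp[x ∑_{k ≥ 2} w_k y^{k-1} / (k-1)!]` in `y`. -/
noncomputable def theta (x : S) (w : ℕ → S) : S⟦X⟧ :=
  (PowerSeries.exp S).subst (x • weightSeries w)

/-- `P_s(x; w) = s! [y^s] θ(x, y; w)`. -/
noncomputable def P (s : ℕ) (x : S) (w : ℕ → S) : S :=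
  (s.factorial : S) * PowerSeries.coeff s (theta x w)

/-- The substitution that defines `θ` is legitimate: the inner series has no constant term. -/
theorem hasSubst_smul_weightSeries (x : S) (w : ℕ → S) :
    PowerSeries.HasSubst (x • weightSeries w) := by
  apply PowerSeries.HasSubst.of_constantCoeff_zero'
  simp [weightSeries, ← PowerSeries.coeff_zero_eq_constantCoeff_apply]

/-- `θ(x, y; w) = ∑_s P_s(x; w) y^s / s!`. -/
theorem theta_eq_mk_P (x : S) (w : ℕ → S) :
    theta x w = PowerSeries.mk fun s => ((s.factorial : ℚ)⁻¹) • P s x w := by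
  ext s
  have h : (s.factorial : ℚ) ≠ 0 := by exact_mod_cast s.factorial_ne_zero
  have h2 : (s.factorial : S) = algebraMap ℚ S (s.factorial : ℚ) := by simp
  rw [PowerSeries.coeff_mk, P, h2, ← Algebra.smul_def, smul_smul, inv_mul_cancel₀ h, one_smul]

end Series

end HyperforestCount

namespace HyperforestCount

/-! ### Reachability and shortest walks. -/

section Reachability

variable {V : Type*} {E : Finset (Finset V)}

/-! Both sides obey the same recursion in `n - r`. Delete a hyperedge `A` from a rooted hyperforest
with `r` components: exactly one vertex of `A` stays joined to an old root, and the other vertices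
of `A` become the roots of the pieces cut off. Conversely, a hyperforest with `r + k + 1` components
yields one with `r` components when `k + 1` of its roots are joined by a hyperedge to a vertex `a`
outside their components; for each of the `n` choices of `a` these roots are taken from the `r + k`
roots other than that of `a` (`sum_marked_edge`, `card_joins`). Marking `A` with multiplicity `|A| -
1` and using `∑ (|A| - 1) = n - r` (`sum_card_sub_one`) gives `(n - r) t_{n,r} = n ∑_k (k + 1) C(r +
k, k + 1) w_{k+2} t_{n,r+k+1}`.

On the other side, differentiating `θ` in `y` gives (`succ_mul_P`) `m P_m = x ∑_k (k + 1) C(m, k +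
1) w_{k+2} P_{m-1-k}`. With `x = n`, a binomial identity turns this into the first recursion for
`C(n-1, r-1) P_{n-r}`. A positive `n - r` is invertible in a `ℚ`-algebra, so induction from `t_{n,n}
= 1 = P_0` concludes (`rootedHyperforestWeight_eq`). -/

theorem Reachable.refl (E : Finset (Finset V)) (u : V) : Reachable E u u :=
  ⟨.nil u⟩

theorem Reachable.head {A : Finset V} {u v x : V} (hA : A ∈ E) (hu : u ∈ A) (hv : v ∈ A)
    (h : Reachable E v x) : Reachable E u x :=
  h.elim fun p => ⟨.cons A hA hu hv p⟩

theorem reachable_of_mem {A : Finset V} {u v : V} (hA : A ∈ E) (hu : u ∈ A) (hv : v ∈ A) :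
    Reachable E u v :=
  .head hA hu hv (.refl E v)

theorem Reachable.trans {u v x : V} (h : Reachable E u v) (h' : Reachable E v x) :
    Reachable E u x := by
  obtain ⟨p⟩ := h
  induction p with
  | nil => exact h'
  | cons A hA hu hv _ ih => exact .head hA hu hv (ih h')

theorem Reachable.symm {u v : V} (h : Reachable E u v) : Reachable E v u := by
  obtain ⟨p⟩ := h
  induction p with
  | nil => exact .refl E _
  | cons A hA hu hv _ ih => exact ih.trans (reachable_of_mem hA hv hu)

theorem Reachable.mono {E' : Finset (Finset V)} (hE : E ⊆ E') {u v : V} (h : Reachable E u v) :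
    Reachable E' u v := by
  obtain ⟨p⟩ := h
  induction p with
  | nil => exact .refl E' _
  | cons A hA hu hv _ ih => exact .head (hE hA) hu hv ih

theorem reachable_empty {u v : V} (h : Reachable (∅ : Finset (Finset V)) u v) : u = v := by
  obtain ⟨p⟩ := h
  cases p with
  | nil => rfl
  | cons A hA => simp at hA

theorem Walk.reachable_subset {u v : V} (p : Walk E u v) {E' : Finset (Finset V)}
    (h : ∀ A ∈ p.edges, A ∈ E') : Reachable E' u v := by
  induction p with
  | nil => exact .refl E' _
  | cons A hA hu hv p ih =>
    simp only [Walk.edges, List.mem_cons, forall_eq_or_imp] at h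
    exact .head h.1 hu hv (ih h.2)

theorem Walk.edges_subset {u v : V} (p : Walk E u v) : ∀ A ∈ p.edges, A ∈ E := by
  induction p with
  | nil => simp [Walk.edges]
  | cons A hA hu hv p ih =>
    simpa only [Walk.edges, List.mem_cons, forall_eq_or_imp] using ⟨hA, ih⟩

/-- A walk can be shortened to start at any of its vertices. -/
theorem Walk.exists_from_vertex {u v x : V} (p : Walk E u v) (hx : x ∈ p.initVertices) :
    ∃ q : Walk E x v, q.length ≤ p.length := by
  induction p with
  | nil => simp [Walk.initVertices] at hx
  | cons A hA hu hv p ih =>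
    simp only [Walk.initVertices, List.mem_cons] at hx
    rcases hx with rfl | hx
    · exact ⟨.cons A hA hu hv p, le_rfl⟩
    · obtain ⟨q, hq⟩ := ih hx
      exact ⟨q, by simp only [Walk.length]; omega⟩

/-- A walk can be shortened to start at any vertex of any of its hyperedges. -/
theorem Walk.exists_from_edge {u v x : V} {A : Finset V} (p : Walk E u v) (hA : A ∈ p.edges)
    (hx : x ∈ A) : ∃ q : Walk E x v, q.length ≤ p.length := by
  induction p with
  | nil => simp [Walk.edges] at hA
  | cons B hB hu hv p ih =>
    simp only [Walk.edges, List.mem_cons] at hA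
    rcases hA with rfl | hA
    · exact ⟨.cons A hB hx hv p, le_rfl⟩
    · obtain ⟨q, hq⟩ := ih hA
      exact ⟨q, by simp only [Walk.length]; omega⟩

/-- A walk of minimal length repeats neither vertices nor hyperedges. -/
theorem Walk.nodup_of_minimal {u v : V} (p : Walk E u v)
    (hp : ∀ q : Walk E u v, p.length ≤ q.length) :
    (p.initVertices ++ [v]).Nodup ∧ p.edges.Nodup := by
  induction p with
  | nil => simp [Walk.initVertices, Walk.edges]
  | @cons u y v A hA hu hv p ih =>
    have hmin (q : Walk E y v) : p.length ≤ q.length := by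
      simpa [Walk.length] using hp (.cons A hA hu hv q)
    obtain ⟨h₁, h₂⟩ := ih hmin
    have hno (q : Walk E u v) (hq : q.length ≤ p.length) : False := by
      have := hp q
      simp only [Walk.length] at this
      omega
    refine ⟨?_, ?_⟩
    · simp only [Walk.initVertices, List.cons_append, List.nodup_cons]
      refine ⟨fun hmem => ?_, h₁⟩
      rw [List.mem_append, List.mem_singleton] at hmem
      rcases hmem with hmem | rfl
      · obtain ⟨q, hq⟩ := p.exists_from_vertex hmem
        exact hno q hq
      · exact hno (.nil u) (Nat.zero_le _)
    · simp only [Walk.edges, List.nodup_cons]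
      refine ⟨fun hmem => ?_, h₂⟩
      obtain ⟨q, hq⟩ := p.exists_from_edge hmem hu
      exact hno q hq

theorem Reachable.exists_nodup_walk {u v : V} (h : Reachable E u v) :
    ∃ p : Walk E u v, (p.initVertices ++ [v]).Nodup ∧ p.edges.Nodup := by
  have hS : (Set.range fun p : Walk E u v => p.length).Nonempty :=
    h.elim fun p => ⟨_, p, rfl⟩
  obtain ⟨p, hp⟩ := Nat.sInf_mem hS
  exact ⟨p, p.nodup_of_minimal fun q => hp.trans_le (Nat.sInf_le ⟨q, rfl⟩)⟩

/-! ### Hyperforests through deletion and insertion of a hyperedge. -/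

/-- A hypergraph is a hyperforest if and only if the deletion of any hyperedge disconnects the
vertices of that hyperedge from each other. -/
theorem isHyperforest_iff [DecidableEq V] :
    IsHyperforest E ↔
      ∀ A ∈ E, ∀ a ∈ A, ∀ b ∈ A, Reachable (E.erase A) a b → a = b := by
  constructor
  · intro h A hA a ha b hb hab
    by_contra hne
    obtain ⟨p, hp, hpe⟩ := hab.exists_nodup_walk
    have hlift : ∀ {x y : V} (q : Walk (E.erase A) x y), ∃ q' : Walk E x y,
        q'.initVertices = q.initVertices ∧ q'.edges = q.edges ∧ q'.length = q.length := by
      intro x y q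
      induction q with
      | nil => exact ⟨.nil _, rfl, rfl, rfl⟩
      | cons B hB hu hv q ih =>
        obtain ⟨q', h1, h2, h3⟩ := ih
        exact ⟨.cons B (Finset.mem_of_mem_erase hB) hu hv q', by simp [Walk.initVertices, h1],
          by simp [Walk.edges, h2], by simp [Walk.length, h3]⟩
    obtain ⟨q, h1, h2, h3⟩ := hlift p
    -- A shortest walk from `a` to `b` avoiding `A` is closed up by `A`; it has at least one step
    -- because `a ≠ b`.
    refine h b (.cons A hA hb ha q) ⟨?_, ?_, ?_⟩
    · rw [Walk.initVertices, h1]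
      exact (List.perm_append_singleton b p.initVertices).nodup_iff.1 hp
    · rw [Walk.edges, h2, List.nodup_cons]
      exact ⟨fun hmem => Finset.notMem_erase A E (p.edges_subset A hmem), hpe⟩
    · rw [Walk.length, h3]
      cases p with
      | nil => exact absurd rfl hne
      | cons => simp [Walk.length]
  · rintro h v p ⟨hv, he, hl⟩
    cases p with
    | nil => simp [Walk.length] at hl
    | @cons _ y _ A hA hu hy p =>
      simp only [Walk.edges, List.nodup_cons] at he
      have hr : Reachable (E.erase A) y v := p.reachable_subset fun B hB =>
        Finset.mem_erase.2 ⟨fun hBA => he.1 (hBA ▸ hB), p.edges_subset B hB⟩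
      -- The rest of the cycle returns from `y` to `v` without `A`. Hence `y = v`, and the vertex
      -- `v` is repeated.
      have hyv : y = v := h A hA y hy v hu hr
      cases p with
      | nil => simp [Walk.length] at hl
      | cons B hB hu' hv' q =>
        simp [Walk.initVertices, hyv] at hv

theorem IsHyperforest.mono {E' : Finset (Finset V)} (h : IsHyperforest E') (hE : E ⊆ E') :
    IsHyperforest E := by
  classical
  rw [isHyperforest_iff] at h ⊢
  exact fun A hA a ha b hb hab =>
    h A (hE hA) a ha b hb (hab.mono (Finset.erase_subset_erase A hE))

theorem isHyperforest_empty : IsHyperforest (∅ : Finset (Finset V)) := by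
  classical
  simp [isHyperforest_iff]

/-- If a walk uses `A`, cut it at the first and the last use: the two outer parts stay in `E`. -/
theorem reachable_insert [DecidableEq V] {A : Finset V} {u v : V}
    (h : Reachable (insert A E) u v) :
    Reachable E u v ∨ ∃ a ∈ A, ∃ b ∈ A, Reachable E u a ∧ Reachable E b v := by
  obtain ⟨p⟩ := h
  induction p with
  | nil => exact .inl (.refl E _)
  | cons B hB hu hv p ih =>
    rcases Finset.mem_insert.1 hB with rfl | hB
    · rcases ih with ih | ⟨a, ha, b, hb, -, h2⟩
      · exact .inr ⟨_, hu, _, hv, .refl E _, ih⟩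
      · exact .inr ⟨_, hu, b, hb, .refl E _, h2⟩
    · rcases ih with ih | ⟨a, ha, b, hb, h1, h2⟩
      · exact .inl (.head hB hu hv ih)
      · exact .inr ⟨a, ha, b, hb, .head hB hu hv h1, h2⟩

theorem Reachable.erase [DecidableEq V] {A : Finset V} {u v : V} (h : Reachable E u v)
    (hA : A ∈ E) : Reachable (E.erase A) u v ∨
      ∃ a ∈ A, ∃ b ∈ A, Reachable (E.erase A) u a ∧ Reachable (E.erase A) b v :=
  reachable_insert ((Finset.insert_erase hA).symm ▸ h)

/-! ### Rooted hyperforests: joining roots and cutting hyperedges. -/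

/-- `F` is a hyperforest, and each of its components contains exactly one element of `R`. -/
def IsRootedHyperforest (F : Finset (Finset V)) (R : Finset V) : Prop :=
  IsHyperforest F ∧ ∀ u, ∃! v, v ∈ R ∧ Reachable F u v

namespace IsRootedHyperforest

variable {F : Finset (Finset V)} {R : Finset V}

theorem unique (h : IsRootedHyperforest F R) {u v x : V} (hv : v ∈ R) (hx : x ∈ R)
    (huv : Reachable F u v) (hux : Reachable F u x) : v = x :=
  (h.2 u).unique ⟨hv, huv⟩ ⟨hx, hux⟩

/-- The root of the component of a vertex. -/
noncomputable def root (h : IsRootedHyperforest F R) (u : V) : V :=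
  (h.2 u).choose

theorem root_mem (h : IsRootedHyperforest F R) (u : V) : h.root u ∈ R :=
  (h.2 u).choose_spec.1.1

theorem reachable_root (h : IsRootedHyperforest F R) (u : V) : Reachable F u (h.root u) :=
  (h.2 u).choose_spec.1.2

/-- An element of `B` is its own root, whereas the root `v` of `a` lies outside `B`. -/
theorem notMem_of_reachable [DecidableEq V] (h : IsRootedHyperforest F R) {B : Finset V}
    {a v : V} (hv : v ∈ R \ B) (hav : Reachable F a v) (hBR : B ⊆ R) : a ∉ B := by
  intro ha
  rw [Finset.mem_sdiff] at hv
  exact hv.2 (h.unique (hBR ha) hv.1 (.refl F a) hav ▸ ha)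

theorem insert_notMem [DecidableEq V] (h : IsRootedHyperforest F R) {B : Finset V} {a v : V}
    (hv : v ∈ R \ B) (hav : Reachable F a v) (hBR : B ⊆ R) (hB : B.Nonempty) :
    insert a B ∉ F := by
  intro hmem
  obtain ⟨b, hb⟩ := hB
  have hab : Reachable F a b :=
    reachable_of_mem hmem (Finset.mem_insert_self a B) (Finset.mem_insert_of_mem hb)
  rw [Finset.mem_sdiff] at hv
  exact hv.2 (h.unique hv.1 (hBR hb) hav hab ▸ hb)

/-- Joining the roots in `B` to a vertex `a` of another component by a new hyperedge. -/
theorem insert_edge [DecidableEq V] (h : IsRootedHyperforest F R) {B : Finset V} {a v : V}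
    (hv : v ∈ R \ B) (hav : Reachable F a v) (hBR : B ⊆ R) (hB : B.Nonempty) :
    IsRootedHyperforest (insert (insert a B) F) (R \ B) := by
  have hA := h.insert_notMem hv hav hBR hB
  have hvR := (Finset.mem_sdiff.1 hv).1
  have hvB := (Finset.mem_sdiff.1 hv).2
  -- The vertices of the new hyperedge lie in distinct components of `F`, so it closes no cycle.
  have hinj : ∀ x ∈ insert a B, ∀ y ∈ insert a B, Reachable F x y → x = y := by
    intro x hx y hy hxy
    rcases Finset.mem_insert.1 hx with hxa | hx' <;> rcases Finset.mem_insert.1 hy with hya | hy'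
    · exact hxa.trans hya.symm
    · subst hxa
      exact absurd (h.unique hvR (hBR hy') hav hxy ▸ hy') hvB
    · subst hya
      exact absurd (h.unique hvR (hBR hx') hav hxy.symm ▸ hx') hvB
    · exact h.unique (hBR hx') (hBR hy') (.refl F x) hxy
  have hmono {x y : V} : Reachable F x y → Reachable (insert (insert a B) F) x y :=
    .mono (Finset.subset_insert _ _)
  refine ⟨?_, fun u => ?_⟩
  · rw [isHyperforest_iff]
    intro C hC x hx y hy hxy
    by_cases hCA : C = insert a B
    · subst hCA
      rw [Finset.erase_insert hA] at hxy
      exact hinj x hx y hy hxy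
    · have hCF : C ∈ F := (Finset.mem_insert.1 hC).resolve_left hCA
      rw [Finset.erase_insert_of_ne (Ne.symm hCA)] at hxy
      have hF := isHyperforest_iff.1 h.1 C hCF
      have hle {x y : V} : Reachable (F.erase C) x y → Reachable F x y :=
        .mono (Finset.erase_subset _ _)
      rcases reachable_insert hxy with hxy | ⟨p, hp, q, hq, hxp, hqy⟩
      · exact hF x hx y hy hxy
      -- The hyperedge `C` joins `p` to `q` within `F`, so the detour through the new hyperedge is
      -- trivial and can be dropped.
      · have hpq : p = q := hinj p hp q hq
          (((hle hxp).symm.trans (reachable_of_mem hCF hx hy)).trans (hle hqy).symm)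
        subst hpq
        exact hF x hx y hy (hxp.trans hqy)
  -- Among the merged components only that of `a` keeps its root, namely `v`.
  · have key : ∀ x ∈ R \ B, Reachable (insert (insert a B) F) u x →
        Reachable F u x ∨ (x = v ∧ ∃ p ∈ insert a B, Reachable F u p) := by
      intro x hx hux
      rcases reachable_insert hux with hux | ⟨p, hp, q, hq, hup, hqx⟩
      · exact .inl hux
      · refine .inr ⟨?_, p, hp, hup⟩
        rcases Finset.mem_insert.1 hq with rfl | hq
        · exact h.unique (Finset.mem_sdiff.1 hx).1 hvR hqx hav
        · exact absurd hq (h.notMem_of_reachable hx hqx hBR)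
    by_cases hr : h.root u ∈ B
    · refine ⟨v, ⟨hv, (hmono (h.reachable_root u)).trans
        (.head (Finset.mem_insert_self _ F) (Finset.mem_insert_of_mem hr)
          (Finset.mem_insert_self a B) (hmono hav))⟩, ?_⟩
      rintro x ⟨hx, hux⟩
      rcases key x hx hux with hux | ⟨hxv, -⟩
      · exact absurd (h.unique (h.root_mem u) (Finset.mem_sdiff.1 hx).1 (h.reachable_root u) hux
          ▸ hr) (Finset.mem_sdiff.1 hx).2
      · exact hxv
    · refine ⟨h.root u, ⟨Finset.mem_sdiff.2 ⟨h.root_mem u, hr⟩, hmono (h.reachable_root u)⟩, ?_⟩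
      rintro x ⟨hx, hux⟩
      rcases key x hx hux with hux | ⟨rfl, p, hp, hup⟩
      · exact h.unique (Finset.mem_sdiff.1 hx).1 (h.root_mem u) hux (h.reachable_root u)
      · rcases Finset.mem_insert.1 hp with rfl | hp
        · exact h.unique hvR (h.root_mem u) (hup.trans hav) (h.reachable_root u)
        · exact absurd (h.unique (hBR hp) (h.root_mem u) hup (h.reachable_root u) ▸ hp) hr

/-- At most one vertex of a hyperedge remains joined to the roots when the hyperedge is deleted. -/
theorem eq_of_erase [DecidableEq V] (h : IsRootedHyperforest F R) {A : Finset V} (hA : A ∈ F)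
    {a b x y : V} (ha : a ∈ A) (hb : b ∈ A) (hx : x ∈ R) (hy : y ∈ R)
    (hax : Reachable (F.erase A) a x) (hby : Reachable (F.erase A) b y) : a = b := by
  have hle {x y : V} : Reachable (F.erase A) x y → Reachable F x y :=
    .mono (Finset.erase_subset _ _)
  have hxy : x = y := h.unique hx hy (hle hax) (.head hA ha hb (hle hby))
  subst hxy
  exact isHyperforest_iff.1 h.1 A hA a ha b hb (hax.trans hby.symm)

/-- At least one vertex of a hyperedge remains joined to the roots when the hyperedge is
deleted. -/
theorem exists_reachable_erase [DecidableEq V] (h : IsRootedHyperforest F R) {A : Finset V}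
    (hA : A ∈ F) (hne : A.Nonempty) : ∃ a ∈ A, ∃ x ∈ R, Reachable (F.erase A) a x := by
  obtain ⟨u, hu⟩ := hne
  have hr := h.reachable_root u
  rcases hr.erase hA with hr | ⟨p, hp, q, hq, -, hqr⟩
  · exact ⟨u, hu, _, h.root_mem u, hr⟩
  · exact ⟨q, hq, _, h.root_mem u, hqr⟩

theorem disjoint_erase [DecidableEq V] (h : IsRootedHyperforest F R) {A : Finset V} (hA : A ∈ F)
    {a x : V} (ha : a ∈ A) (hx : x ∈ R) (hax : Reachable (F.erase A) a x) :
    Disjoint R (A.erase a) := by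
  rw [Finset.disjoint_left]
  intro y hy hyA
  rw [Finset.mem_erase] at hyA
  exact hyA.1 (h.eq_of_erase hA hyA.2 ha hy hx (.refl _ y) hax)

/-- Deleting a hyperedge: its vertices, but one, become new roots. -/
theorem erase_edge [DecidableEq V] (h : IsRootedHyperforest F R) {A : Finset V} (hA : A ∈ F)
    {a x : V} (ha : a ∈ A) (hx : x ∈ R) (hax : Reachable (F.erase A) a x) :
    IsRootedHyperforest (F.erase A) (R ∪ A.erase a) := by
  have hF := isHyperforest_iff.1 h.1
  have hle {x y : V} : Reachable (F.erase A) x y → Reachable F x y :=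
    .mono (Finset.erase_subset _ _)
  refine ⟨h.1.mono (Finset.erase_subset _ _), fun u => existsUnique_of_exists_of_unique ?_ ?_⟩
  · have hr := h.reachable_root u
    rcases hr.erase hA with hr | ⟨p, hp, q, hq, hup, hqr⟩
    · exact ⟨_, Finset.mem_union_left _ (h.root_mem u), hr⟩
    · by_cases hpa : p = a
      · subst hpa
        exact ⟨x, Finset.mem_union_left _ hx, hup.trans hax⟩
      · exact ⟨p, Finset.mem_union_right _ (Finset.mem_erase.2 ⟨hpa, hp⟩), hup⟩
  · rintro y z ⟨hy, huy⟩ ⟨hz, huz⟩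
    have hyz := huy.symm.trans huz
    rw [Finset.mem_union, Finset.mem_erase] at hy hz
    rcases hy with hy | hy <;> rcases hz with hz | hz
    · exact h.unique hy hz (hle huy) (hle huz)
    · exact absurd (h.eq_of_erase hA hz.2 ha hy hx hyz.symm hax) hz.1
    · exact absurd (h.eq_of_erase hA hy.2 ha hz hx hyz hax) hy.1
    · exact hF A hA y hy.2 z hz.2 hyz

/-- In a hyperforest with `r` components on `n` vertices, `∑ (|A| - 1) = n - r`. -/
theorem sum_card_sub_one [Fintype V] (h : IsRootedHyperforest F R)
    (hF : ∀ A ∈ F, A.Nonempty) :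
    R.card + ∑ A ∈ F, (A.card - 1) = Fintype.card V := by
  classical
  -- Cutting `A` trades the summand `|A| - 1` for that many new roots; with no hyperedges left,
  -- every vertex is a root.
  induction F using Finset.strongInduction generalizing R with
  | H F ih =>
    rcases F.eq_empty_or_nonempty with rfl | ⟨A, hA⟩
    · have hR : R = Finset.univ := by
        ext u
        simpa [← reachable_empty (h.reachable_root u)] using h.root_mem u
      simp [hR]
    · obtain ⟨a, ha, x, hx, hax⟩ := h.exists_reachable_erase hA (hF A hA)
      have := ih (F.erase A) (Finset.erase_ssubset hA) (h.erase_edge hA ha hx hax)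
        fun B hB => hF B (Finset.mem_of_mem_erase hB)
      rw [Finset.card_union_of_disjoint (h.disjoint_erase hA ha hx hax),
        Finset.card_erase_of_mem ha] at this
      rw [← Finset.add_sum_erase F (fun A => A.card - 1) hA]
      omega

end IsRootedHyperforest

theorem isHypertree_iff {F : Finset (Finset V)} {v : V} :
    IsHypertree F ↔ IsRootedHyperforest F {v} := by
  refine and_congr_right fun _ => ⟨fun h u => ⟨v, ⟨by simp, h u v⟩, fun x hx => by simpa using hx.1⟩,
    fun h x y => ?_⟩
  have key (u : V) : Reachable F u v := by
    obtain ⟨x, ⟨hx, hux⟩, -⟩ := h u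
    rwa [Finset.mem_singleton.1 hx] at hux
  exact (key x).trans (key y).symm

end Reachability

/-! ### The recursion for the polynomials `P`. -/

section Series

open PowerSeries

variable {S : Type*} [CommRing S] [Algebra ℚ S]

theorem P_zero (x : S) (w : ℕ → S) : P 0 x w = 1 := by
  have h0 : PowerSeries.constantCoeff (x • weightSeries w) = 0 := by
    simp [weightSeries, ← PowerSeries.coeff_zero_eq_constantCoeff_apply]
  rw [P, theta, PowerSeries.coeff_zero_eq_constantCoeff_apply,
    show constantCoeff _ = _ from PowerSeries.constantCoeff_subst (hasSubst_smul_weightSeries x w) _,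
    finsum_eq_single _ 0 fun d hd => ?_]
  · simp
  · have hd' : constantCoeff ((x • weightSeries w) ^ d) = 0 := by
      rw [map_pow, h0, zero_pow hd]
    exact (congrArg (_ • ·) hd').trans (smul_zero _)

theorem derivative_theta (x : S) (w : ℕ → S) :
    derivative S (theta x w) = theta x w * (x • derivative S (weightSeries w)) := by
  rw [theta, derivative_subst (hasSubst_smul_weightSeries x w), derivative_exp,
    (derivative S).map_smul]

theorem factorial_mul_coeff_weightSeries (w : ℕ → S) (k : ℕ) :
    ((k + 1).factorial : S) * coeff (k + 1) (weightSeries w) = w (k + 2) := by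
  have h : ((k + 1).factorial : ℚ) ≠ 0 := by exact_mod_cast (k + 1).factorial_ne_zero
  have h2 : ((k + 1).factorial : S) = algebraMap ℚ S ((k + 1).factorial : ℚ) := by simp
  rw [weightSeries, coeff_mk, if_neg k.succ_ne_zero, h2, ← Algebra.smul_def, smul_smul,
    mul_inv_cancel₀ h, one_smul]

/-- The recursion for `P` that results from comparing coefficients in the derivative of `theta`. -/
theorem succ_mul_P (s : ℕ) (x : S) (w : ℕ → S) :
    ((s + 1 : ℕ) : S) * P (s + 1) x w = x * ∑ k ∈ Finset.range (s + 1),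
      (((k + 1) * (s + 1).choose (k + 1) : ℕ) : S) * (w (k + 2) * P (s - k) x w) := by
  have h := congrArg (coeff s) (derivative_theta x w)
  rw [coeff_derivative, mul_comm (theta x w), coeff_mul,
    Finset.Nat.sum_antidiagonal_eq_sum_range_succ_mk] at h
  have h' : ((s + 1 : ℕ) : S) * P (s + 1) x w
      = ((s + 1).factorial : S) * (coeff (s + 1) (theta x w) * (s + 1)) := by
    rw [P]
    push_cast
    ring
  rw [h', h, Finset.mul_sum, Finset.mul_sum]
  refine Finset.sum_congr rfl fun k hk => ?_
  have hk' : k + 1 ≤ s + 1 := by simpa using hk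
  -- Splitting `(s + 1)!` into `C(s+1, k+1) (k+1)! (s-k)!` normalizes both coefficients; the factor
  -- `k + 1` comes from the derivative of `weightSeries`.
  rw [← factorial_mul_coeff_weightSeries w k, P, coeff_smul, coeff_derivative,
    ← Nat.choose_mul_factorial_mul_factorial hk', Nat.add_sub_add_right]
  simp only [smul_eq_mul]
  push_cast
  ring

end Series

/-! ### Weighted counts of rooted hyperforests. -/

section Counting

variable {V : Type*} [Fintype V]

theorem mem_component {E : Finset (Finset V)} {u v : V} : u ∈ component E v ↔ Reachable E v u := by
  classical
  simp [component]

theorem component_eq_iff {E : Finset (Finset V)} {u v : V} :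
    component E u = component E v ↔ Reachable E u v := by
  constructor
  · intro h
    rw [← mem_component, h, mem_component]
    exact .refl E v
  · intro h
    ext x
    rw [mem_component, mem_component]
    exact ⟨h.symm.trans, h.trans⟩

theorem isRootSet_iff {E : Finset (Finset V)} {R : Finset V} :
    IsRootSet E R ↔ ∀ u, ∃! v, v ∈ R ∧ Reachable E u v := by
  classical
  simp [IsRootSet, components, mem_component, and_comm]

theorem card_components {E : Finset (Finset V)} {R : Finset V} (h : IsRootSet E R) :
    (components E).card = R.card := by
  classical
  rw [isRootSet_iff] at h
  have himage : components E = R.image (component E) := by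
    refine Finset.Subset.antisymm ?_ (Finset.image_subset_image (Finset.subset_univ R))
    intro C hC
    obtain ⟨u, -, rfl⟩ := Finset.mem_image.1 hC
    obtain ⟨v, hv, huv⟩ := (h u).exists
    exact Finset.mem_image.2 ⟨v, hv, (component_eq_iff.2 huv).symm⟩
  rw [himage, Finset.card_image_of_injOn]
  intro u hu v hv huv
  exact (h u).unique ⟨hu, .refl E u⟩ ⟨hv, component_eq_iff.1 huv⟩

theorem mem_rootedSpanningHyperforests {E : Finset (Finset V)} {r : ℕ}
    {FR : Finset (Finset V) × Finset V} :
    FR ∈ rootedSpanningHyperforests E r ↔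
      FR.1 ⊆ E ∧ IsRootedHyperforest FR.1 FR.2 ∧ FR.2.card = r := by
  classical
  simp only [rootedSpanningHyperforests, spanningHyperforests, Finset.mem_filter,
    Finset.mem_product, Finset.mem_powerset, Finset.mem_univ, and_true, IsRootedHyperforest,
    ← isRootSet_iff]
  constructor
  · rintro ⟨⟨h1, h2⟩, h3, h4⟩
    exact ⟨h1, ⟨h2, h4⟩, (card_components h4).symm.trans h3⟩
  · rintro ⟨h1, ⟨h2, h4⟩, h3⟩
    exact ⟨⟨h1, h2⟩, (card_components h4).trans h3, h4⟩

theorem two_le_card_of_mem {F : Finset (Finset V)} (hF : F ⊆ completeHyperedges V)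
    {A : Finset V} (hA : A ∈ F) : 2 ≤ A.card :=
  (Finset.mem_filter.1 (hF hA)).2

variable {S : Type*} [CommRing S]

theorem rootedHyperforestWeight_zero [Nonempty V] (w : ℕ → S) :
    rootedHyperforestWeight V w 0 = 0 := by
  rw [rootedHyperforestWeight, Finset.sum_eq_zero]
  intro FR hFR
  obtain ⟨-, h, hR⟩ := mem_rootedSpanningHyperforests.1 hFR
  obtain ⟨u⟩ := ‹Nonempty V›
  exact absurd (h.root_mem u) (by simp [Finset.card_eq_zero.1 hR])

theorem rootedHyperforestWeight_of_card_lt (w : ℕ → S) {r : ℕ} (hr : Fintype.card V < r) :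
    rootedHyperforestWeight V w r = 0 := by
  rw [rootedHyperforestWeight, Finset.sum_eq_zero]
  intro FR hFR
  obtain ⟨-, -, hR⟩ := mem_rootedSpanningHyperforests.1 hFR
  exact absurd (Finset.card_le_univ FR.2) (by omega)

theorem rootedHyperforestWeight_card (w : ℕ → S) :
    rootedHyperforestWeight V w (Fintype.card V) = 1 := by
  have h : rootedSpanningHyperforests (completeHyperedges V) (Fintype.card V)
      = {(∅, Finset.univ)} := by
    ext ⟨F, R⟩
    rw [mem_rootedSpanningHyperforests, Finset.mem_singleton, Prod.mk.injEq]
    constructor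
    · rintro ⟨h1, h2, h3⟩
      dsimp only at h1 h2 h3
      refine ⟨Finset.eq_empty_of_forall_notMem fun A hA => ?_, Finset.card_eq_iff_eq_univ R |>.1 h3⟩
      have h4 := h2.sum_card_sub_one fun A hA =>
        Finset.card_pos.1 (by have := two_le_card_of_mem h1 hA; omega)
      -- With `n` roots the sum of the `|A| - 1` is zero, but each hyperedge contributes at least
      -- one.
      have h5 := Finset.single_le_sum (f := fun A : Finset V => A.card - 1)
        (fun _ _ => Nat.zero_le _) hA
      have h6 := two_le_card_of_mem h1 hA
      omega
    · rintro ⟨rfl, rfl⟩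
      exact ⟨Finset.empty_subset _, ⟨isHyperforest_empty, fun u =>
        ⟨u, ⟨Finset.mem_univ u, .refl _ u⟩, fun v hv => (reachable_empty hv.2).symm⟩⟩, rfl⟩
  rw [rootedHyperforestWeight, h, Finset.sum_singleton, edgeWeight, Finset.prod_empty]

theorem rootedHypertreeWeight_eq (w : ℕ → S) :
    rootedHypertreeWeight V w = rootedHyperforestWeight V w 1 := by
  classical
  rw [rootedHypertreeWeight, rootedHyperforestWeight, ← Finset.sum_product']
  refine Finset.sum_bij (fun Fv _ => (Fv.1, {Fv.2})) ?_ ?_ ?_ fun _ _ => rfl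
  · rintro ⟨F, v⟩ h
    simp only [spanningHypertrees, Finset.mem_product, Finset.mem_filter,
      Finset.mem_powerset] at h
    exact mem_rootedSpanningHyperforests.2 ⟨h.1.1, isHypertree_iff.1 h.1.2, by simp⟩
  · rintro ⟨F, v⟩ - ⟨F', v'⟩ - h
    simpa using h
  · rintro ⟨F, R⟩ h
    obtain ⟨h1, h2, h3⟩ := mem_rootedSpanningHyperforests.1 h
    obtain ⟨v, rfl⟩ := Finset.card_eq_one.1 h3
    refine ⟨(F, v), ?_, rfl⟩
    simp only [spanningHypertrees, Finset.mem_product, Finset.mem_filter, Finset.mem_powerset,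
      Finset.mem_univ, and_true]
    exact ⟨h1, isHypertree_iff.2 h2⟩

open Classical in
/-- The ways of joining `k` roots of a rooted hyperforest by a new hyperedge to a vertex that lies
in none of their components: pairs of the vertex and the set of the `k` roots. -/
noncomputable def joins (GQ : Finset (Finset V) × Finset V) (k : ℕ) :
    Finset (Σ _ : V, Finset V) :=
  Finset.univ.sigma fun a =>
    (GQ.2.powersetCard k).filter fun B => ∃ x ∈ GQ.2 \ B, Reachable GQ.1 a x

theorem mem_joins [DecidableEq V] {GQ : Finset (Finset V) × Finset V} {k : ℕ}
    {y : Σ _ : V, Finset V} :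
    y ∈ joins GQ k ↔
      (y.2 ⊆ GQ.2 ∧ y.2.card = k) ∧ ∃ x ∈ GQ.2 \ y.2, Reachable GQ.1 y.1 x := by
  simp only [joins, Finset.mem_sigma, Finset.mem_univ, true_and, Finset.mem_filter,
    Finset.mem_powersetCard, Finset.mem_sdiff]

/-- The vertex `a` is arbitrary; the condition on `B` then says only that `B` avoids the root of
`a`. -/
theorem card_joins {GQ : Finset (Finset V) × Finset V} (h : IsRootedHyperforest GQ.1 GQ.2)
    (k : ℕ) : (joins GQ k).card = Fintype.card V * (GQ.2.card - 1).choose k := by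
  classical
  rw [joins, Finset.card_sigma, Fintype.card, ← smul_eq_mul, ← Finset.sum_const]
  refine Finset.sum_congr rfl fun a _ => ?_
  rw [← Finset.card_erase_of_mem (h.root_mem a), ← Finset.card_powersetCard]
  congr 1
  ext B
  simp only [Finset.mem_filter, Finset.mem_powersetCard, Finset.subset_erase]
  constructor
  · rintro ⟨⟨h1, h2⟩, x, hx, hax⟩
    rw [Finset.mem_sdiff] at hx
    exact ⟨⟨h1, h.unique hx.1 (h.root_mem a) hax (h.reachable_root a) ▸ hx.2⟩, h2⟩
  · rintro ⟨⟨h1, h3⟩, h2⟩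
    exact ⟨⟨h1, h2⟩, _, Finset.mem_sdiff.2 ⟨h.root_mem a, h3⟩, h.reachable_root a⟩

/-- Rooted hyperforests with `r` components and a marked hyperedge of cardinality `k + 2` are
obtained from those with `r + k + 1` components by joining `k + 1` roots to a vertex. -/
theorem sum_marked_edge (w : ℕ → S) (r k : ℕ) :
    ∑ FR ∈ rootedSpanningHyperforests (completeHyperedges V) r,
      ∑ _A ∈ FR.1.filter (fun A => A.card = k + 2), edgeWeight w FR.1 =
    ∑ GQ ∈ rootedSpanningHyperforests (completeHyperedges V) (r + k + 1),
      ∑ _y ∈ joins GQ (k + 1), w (k + 2) * edgeWeight w GQ.1 := by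
  classical
  rw [Finset.sum_sigma', Finset.sum_sigma']
  symm
  refine Finset.sum_bij (fun z _ =>
    ⟨(insert (insert z.2.1 z.2.2) z.1.1, z.1.2 \ z.2.2), insert z.2.1 z.2.2⟩) ?_ ?_ ?_ ?_
  · rintro ⟨⟨G, Q⟩, a, B⟩ hz
    simp only [Finset.mem_sigma, mem_rootedSpanningHyperforests, mem_joins] at hz
    obtain ⟨⟨hG, h, hQ⟩, ⟨hBQ, hB⟩, x, hx, hax⟩ := hz
    have haB := h.notMem_of_reachable hx hax hBQ
    have hcard : (insert a B).card = k + 2 := by rw [Finset.card_insert_of_notMem haB, hB]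
    simp only [Finset.mem_sigma, mem_rootedSpanningHyperforests, Finset.mem_filter,
      Finset.mem_insert_self, true_and]
    refine ⟨⟨Finset.insert_subset (Finset.mem_filter.2 ⟨Finset.mem_univ _, by omega⟩) hG,
      h.insert_edge hx hax hBQ (Finset.card_pos.1 (by omega)), ?_⟩, hcard⟩
    rw [Finset.card_sdiff_of_subset hBQ]
    omega
  · rintro ⟨⟨G, Q⟩, a, B⟩ hz ⟨⟨G', Q'⟩, a', B'⟩ hz' heq
    simp only [Finset.mem_sigma, mem_rootedSpanningHyperforests, mem_joins] at hz hz'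
    obtain ⟨⟨hG, h, hQ⟩, ⟨hBQ, hB⟩, x, hx, hax⟩ := hz
    obtain ⟨⟨hG', h', hQ'⟩, ⟨hBQ', hB'⟩, x', hx', hax'⟩ := hz'
    simp only [Sigma.mk.injEq, Prod.mk.injEq, heq_eq_eq] at heq
    obtain ⟨⟨hF, hR⟩, hA⟩ := heq
    have hne : B.Nonempty := Finset.card_pos.1 (by omega)
    have hne' : B'.Nonempty := Finset.card_pos.1 (by omega)
    have hGA := h.insert_notMem hx hax hBQ hne
    have hGA' := h'.insert_notMem hx' hax' hBQ' hne'
    have hGG : G = G' := by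
      rw [← Finset.erase_insert hGA, hF, hA, Finset.erase_insert hGA']
    subst hGG
    -- The join is recovered from its result: `a` is the only vertex of the marked hyperedge that
    -- still reaches a remaining root once that hyperedge is deleted.
    have haa : a = a' := by
      refine (h.insert_edge hx hax hBQ hne).eq_of_erase (A := insert a B) (x := x) (y := x')
        (Finset.mem_insert_self _ _) (Finset.mem_insert_self _ _)
        (hA ▸ Finset.mem_insert_self _ _) hx (hR ▸ hx') ?_ ?_
      · rwa [Finset.erase_insert hGA]
      · rwa [Finset.erase_insert hGA]
    subst haa
    have hBB : B = B' := by
      rw [← Finset.erase_insert (h.notMem_of_reachable hx hax hBQ), hA,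
        Finset.erase_insert (h'.notMem_of_reachable hx' hax' hBQ')]
    subst hBB
    have hQQ : Q = Q' := by
      rw [← Finset.sdiff_union_of_subset hBQ, hR, Finset.sdiff_union_of_subset hBQ']
    rw [hQQ]
  · rintro ⟨⟨F, R⟩, A⟩ hz
    simp only [Finset.mem_sigma, mem_rootedSpanningHyperforests, Finset.mem_filter] at hz
    obtain ⟨⟨hF, h, hR⟩, hA, hAk⟩ := hz
    obtain ⟨a, ha, x, hx, hax⟩ := h.exists_reachable_erase hA (Finset.card_pos.1 (by omega))
    have hdisj := h.disjoint_erase hA ha hx hax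
    refine ⟨⟨(F.erase A, R ∪ A.erase a), a, A.erase a⟩, ?_, ?_⟩
    · simp only [Finset.mem_sigma, mem_rootedSpanningHyperforests, mem_joins]
      refine ⟨⟨(Finset.erase_subset _ _).trans hF, h.erase_edge hA ha hx hax, ?_⟩,
        ⟨Finset.subset_union_right, ?_⟩, x, ?_, hax⟩
      · rw [Finset.card_union_of_disjoint hdisj, Finset.card_erase_of_mem ha]
        omega
      · rw [Finset.card_erase_of_mem ha]
        omega
      · rwa [Finset.union_sdiff_cancel_right hdisj]
    · simp only [Finset.insert_erase ha, Finset.insert_erase hA,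
        Finset.union_sdiff_cancel_right hdisj]
  · rintro ⟨⟨G, Q⟩, a, B⟩ hz
    simp only [Finset.mem_sigma, mem_rootedSpanningHyperforests, mem_joins] at hz
    obtain ⟨⟨hG, h, hQ⟩, ⟨hBQ, hB⟩, x, hx, hax⟩ := hz
    have haB := h.notMem_of_reachable hx hax hBQ
    simp only [edgeWeight]
    rw [Finset.prod_insert (h.insert_notMem hx hax hBQ (Finset.card_pos.1 (by omega))),
      Finset.card_insert_of_notMem haB, hB]

/-- The recursion for the weights of rooted hyperforests that results from deleting hyperedges. -/
theorem succ_mul_rootedHyperforestWeight (w : ℕ → S) (r s : ℕ)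
    (hrs : r + (s + 1) = Fintype.card V) :
    ((s + 1 : ℕ) : S) * rootedHyperforestWeight V w r =
      (Fintype.card V : S) * ∑ k ∈ Finset.range (s + 1),
        (((k + 1) * (r + k).choose (k + 1) : ℕ) : S) *
          (w (k + 2) * rootedHyperforestWeight V w (r + k + 1)) := by
  have hleft : ((s + 1 : ℕ) : S) * rootedHyperforestWeight V w r =
      ∑ k ∈ Finset.range (s + 1), ((k + 1 : ℕ) : S) *
        ∑ FR ∈ rootedSpanningHyperforests (completeHyperedges V) r,
          ∑ _A ∈ FR.1.filter (fun A => A.card = k + 2), edgeWeight w FR.1 := by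
    simp only [rootedHyperforestWeight, Finset.mul_sum]
    rw [Finset.sum_comm]
    refine Finset.sum_congr rfl fun FR hFR => ?_
    obtain ⟨hF, h, hR⟩ := mem_rootedSpanningHyperforests.1 hFR
    have hcount := h.sum_card_sub_one fun A hA =>
      Finset.card_pos.1 (by have := two_le_card_of_mem hF hA; omega)
    have hsum : ∑ A ∈ FR.1, (A.card - 1) = s + 1 := by omega
    have hmaps : ∀ A ∈ FR.1, A.card - 2 ∈ Finset.range (s + 1) := by
      intro A hA
      have h1 := Finset.single_le_sum (f := fun A : Finset V => A.card - 1)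
        (fun _ _ => Nat.zero_le _) hA
      have h2 := two_le_card_of_mem hF hA
      rw [Finset.mem_range]
      omega
    -- The factor `n - r` becomes a marked hyperedge with multiplicity `|A| - 1`, to be sorted by `k
    -- = |A| - 2`.
    have hcast : ((s + 1 : ℕ) : S) = ∑ A ∈ FR.1, ((A.card - 1 : ℕ) : S) := by
      rw [← hsum, Nat.cast_sum]
    rw [hcast, Finset.sum_mul, ← Finset.sum_fiberwise_of_maps_to hmaps]
    refine Finset.sum_congr rfl fun k _ => ?_
    have hfilter : FR.1.filter (fun A => A.card - 2 = k) =
        FR.1.filter (fun A => A.card = k + 2) := by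
      refine Finset.filter_congr fun A hA => ?_
      have := two_le_card_of_mem hF hA
      omega
    rw [hfilter]
    refine Finset.sum_congr rfl fun A hA => ?_
    rw [(Finset.mem_filter.1 hA).2, Nat.add_sub_assoc (by norm_num)]
  rw [hleft, Finset.mul_sum]
  refine Finset.sum_congr rfl fun k _ => ?_
  rw [sum_marked_edge, rootedHyperforestWeight, Finset.mul_sum, Finset.mul_sum, Finset.mul_sum,
    Finset.mul_sum]
  refine Finset.sum_congr rfl fun GQ hGQ => ?_
  obtain ⟨-, h, hQ⟩ := mem_rootedSpanningHyperforests.1 hGQ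
  rw [Finset.sum_const, card_joins h, hQ, nsmul_eq_mul, Nat.add_sub_cancel]
  push_cast
  ring

/-- Writing the number of components as `r + 1` keeps truncated subtraction out of the binomial
coefficient. Strong induction is needed because the recursion reaches every `s - k`. -/
theorem rootedHyperforestWeight_eq [Algebra ℚ S] (w : ℕ → S) (s r : ℕ)
    (hrs : r + 1 + s = Fintype.card V) :
    rootedHyperforestWeight V w (r + 1) =
      ((r + s).choose r : S) * P s (Fintype.card V : S) w := by
  induction s using Nat.strong_induction_on generalizing r with
  | _ s ih =>
    cases s with
    | zero =>
      rw [add_zero] at hrs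
      rw [hrs, rootedHyperforestWeight_card, P_zero]
      simp
    | succ s =>
      have hu : IsUnit ((s + 1 : ℕ) : S) := by
        have h : IsUnit ((s + 1 : ℕ) : ℚ) :=
          isUnit_iff_ne_zero.2 (Nat.cast_ne_zero.2 s.succ_ne_zero)
        simpa using h.map (algebraMap ℚ S)
      refine hu.mul_left_cancel ?_
      rw [succ_mul_rootedHyperforestWeight w (r + 1) s hrs, mul_left_comm, succ_mul_P,
        mul_left_comm, Finset.mul_sum (a := ((r + (s + 1)).choose r : S))]
      congr 1
      refine Finset.sum_congr rfl fun k hk => ?_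
      have hk' : k ≤ s := Nat.lt_succ_iff.1 (Finset.mem_range.1 hk)
      rw [show r + 1 + k + 1 = (r + k + 1) + 1 by omega, ih (s - k) (by omega) (r + k + 1) (by omega)]
      have hc : (r + 1 + k).choose (k + 1) * (r + k + 1 + (s - k)).choose (r + k + 1) =
          (r + (s + 1)).choose r * (s + 1).choose (k + 1) := by
        -- Nested subsets of sizes `r ≤ r + k + 1` in a set of `r + s + 1` elements, chosen from the
        -- outside or from the inside.
        have h1 := Nat.choose_mul (n := r + (s + 1)) (k := r + k + 1) (s := r) (by omega)
        rw [show r + (s + 1) - r = s + 1 by omega, show r + k + 1 - r = k + 1 by omega] at h1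
        rw [← h1, show r + k + 1 + (s - k) = r + (s + 1) by omega, mul_comm,
          show r + 1 + k = r + k + 1 by omega,
          Nat.choose_symm_of_eq_add (show r + k + 1 = r + (k + 1) by omega)]
      have hc' := congrArg (Nat.cast : ℕ → S) hc
      push_cast at hc' ⊢
      linear_combination ((k : S) + 1) * w (k + 2) * P (s - k) (Fintype.card V : S) w * hc'

end Counting

end HyperforestCount

theorem mainTheorem1 {S : Type*} [CommRing S] [Algebra ℚ S] (w : ℕ → S)
    (V : Type*) [Fintype V] (n : ℕ) (hn : 1 ≤ n) (hV : Fintype.card V = n) :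
    (∀ r : ℕ, 1 ≤ r →
      HyperforestCount.rootedHyperforestWeight V w r =
        ((n - 1).choose (r - 1) : S) * HyperforestCount.P (n - r) (n : S) w) ∧
    HyperforestCount.rootedHyperforestWeight V w 0 = 0 ∧
    HyperforestCount.rootedHyperforestWeight V w n = 1 ∧
    HyperforestCount.rootedHyperforestWeight V w 1 = HyperforestCount.P (n - 1) (n : S) w ∧
    HyperforestCount.rootedHypertreeWeight V w = HyperforestCount.P (n - 1) (n : S) w := by
  have hmain : ∀ r : ℕ, 1 ≤ r →
      HyperforestCount.rootedHyperforestWeight V w r =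
        ((n - 1).choose (r - 1) : S) * HyperforestCount.P (n - r) (n : S) w := by
    intro r hr
    -- For `r > n` the truncated `n - r` gives `P 0 = 1`; it is the binomial coefficient that
    -- vanishes.
    rcases le_or_gt r n with hrn | hrn
    · have h := HyperforestCount.rootedHyperforestWeight_eq (V := V) w (n - r) (r - 1) (by omega)
      rwa [hV, show r - 1 + 1 = r by omega, show r - 1 + (n - r) = n - 1 by omega] at h
    · rw [HyperforestCount.rootedHyperforestWeight_of_card_lt w (hV.trans_lt hrn),
        Nat.choose_eq_zero_of_lt (by omega), Nat.cast_zero, zero_mul]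
  have hone : HyperforestCount.rootedHyperforestWeight V w 1 =
      HyperforestCount.P (n - 1) (n : S) w := by
    simpa using hmain 1 le_rfl
  have : Nonempty V := Fintype.card_pos_iff.1 (by omega)
  exact ⟨hmain, HyperforestCount.rootedHyperforestWeight_zero w,
    hV ▸ HyperforestCount.rootedHyperforestWeight_card w, hone,
    (HyperforestCount.rootedHypertreeWeight_eq w).trans hone⟩
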